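/- **Labelled transition systems.** A labelled transition system (LTS) $s$ consists of a non-empty set of states $Q_s$, disjoint sets $I_s$ (inputs) and $U_s$ (outputs) of labels, a transition relation $T_s\subseteq Q_s\times(I_s\cup U_s\cup\{\tau\})\times Q_s$ and an initial state; write $L_s=I_s\cup U_s$. A state is quiescent if it has no transition labelled by $\tau$ or by an output; $q\xrightarrow{\delta}q'$ means that $q=q'$ is quiescent, and $L_s^\delta=L_s\cup\{\delta\}$, $U_s^\delta=U_s\cup\{\delta\}$, where $\delta\notin L_s$. For $\sigma\in (L_s^\delta)^*$, $q\xRightarrow{\sigma}q'$ means that $q'$ can be reached from $q$ by the steps of $\sigma$, interleaved with finitely many $\tau$-transitions; $q\xRightarrow{\sigma}$ means that some such $q'$ exists, and $s\xRightarrow{\sigma}$ refers to the initial state of $s$. For a set $X$ of states, $X\text{ after }\sigma=\{q'\mid \exists q\in X:\ q\xRightarrow{\sigma}q'\}$, $\mathrm{out}(X)=\{x\in U_s^\delta\mid\exists q\in X:\ q\xrightarrow{x}\}$ and $\mathrm{in}(X)=\{\ell\in I_s\mid\forall q\in X:\ q\xRightarrow{\ell}\}$. $s$ is input-enabled if $q\xRightarrow{\ell}$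 for all $q\in Q_s$, $\ell\in I_s$. $\mathrm{Utraces}(s)$ is the set of all $\sigma$ with $s\xRightarrow{\sigma}$ such that whenever $\sigma=\sigma_1\cdot\ell\cdot\sigma_2$ with $\ell\in I_s$ and $s\xRightarrow{\sigma_1}q$, then $q\xRightarrow{\ell}$. $s$ is utrace-closed if $s\xRightarrow{\sigma}$ implies $\sigma\in\mathrm{Utraces}(s)$. For an input-enabled $i$ with $I_i=I_s$ and $U_i=U_s$, $i\ \mathbf{uioco}\ s$ means $\mathrm{out}(i\text{ after }\sigma)\subseteq\mathrm{out}(s\text{ after }\sigma)$ for all $\sigma\in\mathrm{Utraces}(s)$. $s$ and $e$ are composable if $U_s\cap U_e=\emptyset$. Their parallel composition $s\parallel e$ has states $Q_s\times Q_e$, inputs $(I_s\setminus U_e)\cup(I_e\setminus U_s)$, outputs $U_s\cup U_e$ and the pair of initial states as initial state; the two components synchronise on labels in $L_s\cap L_e$, and each performs $\tau$ and its other labels alone. **Tests.** A test for $(s,e)$ is a behaviour expression (pass, fail, prefix $\ell;B$, or a choice $\sum$ over a family of behaviour expressions, with $+$ for binary choice), with inputs $I_t=U_s\cup\{\theta,\theta_s\}$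 and outputs $U_t=U_e\cup(I_e\setminus U_s)\cup(I_s\setminus L_e)$; pass and fail loop on every label in $I_t$. The tests generated by the combined algorithm for $(s,e)$ are the possible results of $\mathrm{Gen}(\{q_0\}\text{ after }\epsilon)$, where $q_0$ is the initial state of $s\parallel e$ and the nondeterministic terminating procedure $\mathrm{Gen}(X)$, $X\subseteq Q_s\times Q_e$, is the following. Here out, in and after of $X$ are those of $s\parallel e$, and $\pi_1,\pi_2$ are the projections to $Q_s$ and $Q_e$. $\mathrm{Gen}(X)$ returns one of * (A) pass; * (B) $\ell;\mathrm{Gen}(X\text{ after }\ell)+\mathrm{Resp}(X)$, for some $\ell\in\mathrm{in}(\pi_1(X))\cap(\mathrm{in}(X)\cup\mathrm{out}(X))$; * (C) $B_\theta+\mathrm{Resp}(X)$, where $B_\theta$ is $\theta;\text{fail}$ if $\delta\notin\mathrm{out}(\pi_1(X))$; otherwise $\theta;\mathrm{Gen}(X\text{ after }\delta)$ if $\delta\in\mathrm{out}(X)$; otherwise $\theta_s;\mathrm{Gen}(X)$; * (D) $\ell;\mathrm{Gen}(X\text{ after }\ell)+\mathrm{Resp}(X)$, for some label $\ell\in(\mathrm{out}(X)\cup\mathrm{in}(X))\setminus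 L_s^\delta$; and $\mathrm{Resp}(X)$ is the choice between all $\ell;\text{fail}$ with $\ell\in(U_s\cap I_e)\setminus\mathrm{in}(\pi_2(X))$, all $\ell;\text{fail}$ with $\ell\in U_s\setminus\mathrm{out}(X)$, and all $\ell;\mathrm{Gen}(X\text{ after }\ell)$ with $\ell\in U_s\cap\mathrm{in}(\pi_2(X))\cap\mathrm{out}(X)$ or $\ell\in(U_s\setminus L_e)\cap\mathrm{out}(X)$. **Execution.** In the execution of a test $t$ on an input-enabled $i$, the states are pairs of a state of $t$ and a state of $i$; $t$ and $i$ synchronise on $L_t\cap L_i$; $i$ performs $\tau$ and labels in $L_i\setminus L_t$ alone; $t$ performs labels in $L_t\setminus(L_i\cup\{\theta,\theta_s\})$ alone; and $t$ performs $\theta$ or $\theta_s$ only if $i$ is quiescent (its state being unchanged). $i$ passes $t$ if no execution run of $t$ on $i$ reaches fail. **Theorem.** Let $s$ and $e$ be composable, utrace-closed LTSs. Let $i_s$ and $i_e$ be input-enabled LTSs with $I_{i_s}=I_s$, $U_{i_s}=U_s$, $I_{i_e}=I_e$, $U_{i_e}=U_e$. Suppose that $i_s$ passes every test generated by the combined algorithm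 for $(s,e)$, and that $i_e$ passes every test generated by it for $(e,s)$. Then $$i_s\parallel i_e\ \ \mathbf{uioco}\ \ s\parallel e .$$ In particular, $i_s\parallel i_e$ is input-enabled with the same inputs and outputs as $s\parallel e$. -/

import Mathlib

universe u v w

namespace CompTest

/-- Labels of a single transition: the internal action `tau` or a label. -/
inductive Act (Λ : Type u) : Type u
  | tau : Act Λ
  | lab : Λ → Act Λ

/-- Elements of `L^δ`: quiescence `delta` or a label. -/
inductive Obs (Λ : Type u) : Type u
  | delta : Obs Λ
  | lab : Λ → Obs Λ

/-- A labelled transition system with labels from `Λ` and set of states `Q`. No countability,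
image-finiteness or convergence is required. -/
structure LTS (Λ : Type u) (Q : Type v) where
  /-- input labels -/
  I : Set Λ
  /-- output labels -/
  U : Set Λ
  /-- transition relation -/
  T : Q → Act Λ → Q → Prop
  /-- initial state -/
  q0 : Q
  disj : Disjoint I U
  wf : ∀ q ℓ q', T q (Act.lab ℓ) q' → ℓ ∈ I ∪ U

namespace LTS

variable {Λ : Type u} {Q : Type v}

/-- All labels of `s`. -/
def L (s : LTS Λ Q) : Set Λ := s.I ∪ s.U

/-- `q` is quiescent: neither an output nor an internal transition is possible. -/
def Quiescent (s : LTS Λ Q) (q : Q) : Prop :=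
  (∀ q', ¬ s.T q Act.tau q') ∧ ∀ x ∈ s.U, ∀ q', ¬ s.T q (Act.lab x) q'

/-- The single arrow `q -x→ q'` for `x` in `L^δ`. -/
def Step (s : LTS Λ Q) (q : Q) : Obs Λ → Q → Prop
  | Obs.delta, q' => q = q' ∧ s.Quiescent q
  | Obs.lab ℓ, q' => s.T q (Act.lab ℓ) q'

/-- `q ⇒ε q'`: finitely many internal transitions. -/
def Eps (s : LTS Λ Q) : Q → Q → Prop :=
  Relation.ReflTransGen fun q q' => s.T q Act.tau q'

/-- The double arrow `q ⇒σ q'`. -/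
def Weak (s : LTS Λ Q) : Q → List (Obs Λ) → Q → Prop
  | q, [], q' => s.Eps q q'
  | q, x :: σ, q' => ∃ q₁ q₂, s.Eps q q₁ ∧ s.Step q₁ x q₂ ∧ s.Weak q₂ σ q'

/-- `q ⇒σ` -/
def CanWeak (s : LTS Λ Q) (q : Q) (σ : List (Obs Λ)) : Prop := ∃ q', s.Weak q σ q'

/-- The double arrow can equally be unfolded at the last label of the trace. -/
theorem weak_snoc (s : LTS Λ Q) (σ : List (Obs Λ)) (x : Obs Λ) (q q' : Q) :
    s.Weak q (σ ++ [x]) q' ↔ ∃ q₁ q₂, s.Weak q σ q₁ ∧ s.Step q₁ x q₂ ∧ s.Eps q₂ q' := by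
  induction σ generalizing q with
  | nil => simp [Weak]
  | cons y σ ih =>
    simp only [List.cons_append, Weak, ih]
    constructor
    · rintro ⟨a, b, h1, h2, c, d, h3, h4, h5⟩
      exact ⟨c, d, ⟨a, b, h1, h2, h3⟩, h4, h5⟩
    · rintro ⟨c, d, ⟨a, b, h1, h2, h3⟩, h4, h5⟩
      exact ⟨a, b, h1, h2, c, d, h3, h4, h5⟩

/-- `X after σ`, for a set of states `X`. -/
def after (s : LTS Λ Q) (X : Set Q) (σ : List (Obs Λ)) : Set Q :=
  {q' | ∃ q ∈ X, s.Weak q σ q'}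

/-- The outputs, possibly including quiescence, enabled in some state of `X`. -/
def out (s : LTS Λ Q) (X : Set Q) : Set (Obs Λ) :=
  {x | (x = Obs.delta ∨ ∃ ℓ ∈ s.U, x = Obs.lab ℓ) ∧ ∃ q ∈ X, ∃ q', s.Step q x q'}

/-- The inputs weakly enabled in every state of `X`. -/
def inp (s : LTS Λ Q) (X : Set Q) : Set Λ :=
  {ℓ | ℓ ∈ s.I ∧ ∀ q ∈ X, s.CanWeak q [Obs.lab ℓ]}

/-- Membership in the class of input-enabled transition systems. -/
def InputEnabled (s : LTS Λ Q) : Prop :=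
  ∀ q, ∀ ℓ ∈ s.I, s.CanWeak q [Obs.lab ℓ]

/-- The utraces of `s`. -/
def Utraces (s : LTS Λ Q) : Set (List (Obs Λ)) :=
  {σ | s.CanWeak s.q0 σ ∧
    ∀ (q : Q) (σ₁ : List (Obs Λ)) (ℓ : Λ) (σ₂ : List (Obs Λ)),
      σ₁ ++ Obs.lab ℓ :: σ₂ = σ → ℓ ∈ s.I → s.Weak s.q0 σ₁ q → s.CanWeak q [Obs.lab ℓ]}

/-- Every trace (with quiescence) is a utrace. -/
def UtraceClosed (s : LTS Λ Q) : Prop :=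
  ∀ σ : List (Obs Λ), s.CanWeak s.q0 σ → σ ∈ s.Utraces

end LTS

/-- `i uioco s`, including that `i` is input-enabled with the same labels as `s`. -/
structure Uioco {Λ : Type u} {Q : Type v} {Q' : Type w} (i : LTS Λ Q) (s : LTS Λ Q') : Prop where
  inputEnabled : i.InputEnabled
  inputs_eq : i.I = s.I
  outputs_eq : i.U = s.U
  out_subset : ∀ σ ∈ s.Utraces, i.out (i.after {i.q0} σ) ⊆ s.out (s.after {s.q0} σ)

/-- Disjoint output sets. -/
def Composable {Λ : Type u} {Q : Type v} {Q' : Type w} (s : LTS Λ Q) (e : LTS Λ Q') : Prop :=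
  Disjoint s.U e.U

/-- Transition rules of parallel composition. -/
inductive ParStep {Λ : Type u} {Q : Type v} {Q' : Type w} (s : LTS Λ Q) (e : LTS Λ Q') :
    Q × Q' → Act Λ → Q × Q' → Prop
  | left_tau {p p' r} : s.T p Act.tau p' → ParStep s e (p, r) Act.tau (p', r)
  | left {p p' r ℓ} : s.T p (Act.lab ℓ) p' → ℓ ∉ e.L → ParStep s e (p, r) (Act.lab ℓ) (p', r)
  | right_tau {p r r'} : e.T r Act.tau r' → ParStep s e (p, r) Act.tau (p, r')
  | right {p r r' ℓ} : e.T r (Act.lab ℓ) r' → ℓ ∉ s.L → ParStep s e (p, r) (Act.lab ℓ) (p, r')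
  | sync {p p' r r' ℓ} : s.T p (Act.lab ℓ) p' → e.T r (Act.lab ℓ) r' →
      ParStep s e (p, r) (Act.lab ℓ) (p', r')

/-- Parallel composition. -/
def par {Λ : Type u} {Q : Type v} {Q' : Type w} (s : LTS Λ Q) (e : LTS Λ Q') :
    LTS Λ (Q × Q') where
  I := (s.I \ e.U) ∪ (e.I \ s.U)
  U := s.U ∪ e.U
  T := ParStep s e
  q0 := (s.q0, e.q0)
  disj := by
    have h1 := Set.disjoint_left.1 s.disj
    have h2 := Set.disjoint_left.1 e.disj
    rw [Set.disjoint_left]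
    rintro ℓ (⟨a, b⟩ | ⟨a, b⟩) (c | c)
    · exact h1 a c
    · exact b c
    · exact b c
    · exact h2 a c
  wf := by
    intro q ℓ q' h
    have h1 := Set.disjoint_left.1 s.disj
    have h2 := Set.disjoint_left.1 e.disj
    simp only [Set.mem_union, Set.mem_sdiff]
    cases h with
    | left h hn =>
      have := s.wf _ _ _ h
      simp only [LTS.L, Set.mem_union] at this hn
      tauto
    | right h hn =>
      have := e.wf _ _ _ h
      simp only [LTS.L, Set.mem_union] at this hn
      tauto
    | sync h h' =>
      have a := s.wf _ _ _ h
      have b := e.wf _ _ _ h'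
      simp only [Set.mem_union] at a b
      tauto

/-- Labels of test cases: the labels of the systems and two special labels for observing
quiescence. -/
inductive TLab (Λ : Type u) : Type u
  | lab : Λ → TLab Λ
  | theta : TLab Λ
  | thetaS : TLab Λ

/-- Behaviour expressions over the labels `M`. The two terminal states are constants because
their defining equations, a loop for every input, are recursive. -/
inductive Beh (M : Type u) : Type (u + 1)
  | pass : Beh M
  | fail : Beh M
  | seq : M → Beh M → Beh M
  | sum : (ι : Type u) → (ι → Beh M) → Beh M

namespace Beh

variable {M : Type u}

/-- Binary choice. -/
def choice (A B : Beh M) : Beh M :=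
  sum (ULift.{u} Bool) fun b => if b.down then A else B

/-- The sum of all `ℓ ; B ℓ` with `ℓ` in `S`. -/
def sumOver {Λ : Type u} (S : Set Λ) (B : Λ → Beh (TLab Λ)) : Beh (TLab Λ) :=
  sum S fun ℓ => seq (TLab.lab ℓ.1) (B ℓ.1)

/-- Transitions of behaviour expressions, for a test case with inputs `It`. -/
inductive Step (It : Set M) : Beh M → M → Beh M → Prop
  | pass {ℓ} : ℓ ∈ It → Step It pass ℓ pass
  | fail {ℓ} : ℓ ∈ It → Step It fail ℓ fail
  | seq {ℓ B} : Step It (seq ℓ B) ℓ B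
  | sum {ι F i ℓ B'} : Step It (F i) ℓ B' → Step It (sum ι F) ℓ B'

end Beh

section Gen

variable {Λ : Type u} {Q : Type v} {Q' : Type w}

/-- The reaction of a test to outputs of the system under test in the set `X` of states of
`s ∥ e`; `B ℓ` is the test with which the output `ℓ` is followed up where it is correct. -/
def inputResponse (s : LTS Λ Q) (e : LTS Λ Q') (X : Set (Q × Q')) (B : Λ → Beh (TLab Λ)) :
    Beh (TLab Λ) :=
  ((Beh.sumOver ((s.U ∩ e.I) \ e.inp (Prod.snd '' X)) fun _ => Beh.fail).choice
    (Beh.sumOver {ℓ | ℓ ∈ s.U ∧ Obs.lab ℓ ∉ (par s e).out X} fun _ => Beh.fail)).choice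
  ((Beh.sumOver
      {ℓ | ℓ ∈ s.U ∧ ℓ ∈ e.inp (Prod.snd '' X) ∧ Obs.lab ℓ ∈ (par s e).out X} B).choice
    (Beh.sumOver {ℓ | ℓ ∈ s.U ∧ ℓ ∉ e.L ∧ Obs.lab ℓ ∈ (par s e).out X} B))

/-- The outputs of the system under test after which the test is continued. -/
def contOutputs (s : LTS Λ Q) (e : LTS Λ Q') (X : Set (Q × Q')) : Set Λ :=
  {ℓ | ℓ ∈ s.U ∧ (ℓ ∈ e.inp (Prod.snd '' X) ∨ ℓ ∉ e.L) ∧ Obs.lab ℓ ∈ (par s e).out X}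

/-- `GenCombinedTest s e X B`: the nondeterministic procedure, called on the set `X` of states of
`s ∥ e`, can return `B`. In each case but the first, `R ℓ` is the result of the recursive call
made for the continued output `ℓ`. -/
inductive GenCombinedTest (s : LTS Λ Q) (e : LTS Λ Q') :
    Set (Q × Q') → Beh (TLab Λ) → Prop
  /-- stop testing -/
  | halt (X : Set (Q × Q')) : GenCombinedTest s e X Beh.pass
  /-- give an input to the system under test -/
  | emit (X : Set (Q × Q')) (ℓ : Λ) (B : Beh (TLab Λ)) (R : Λ → Beh (TLab Λ)) :
      ℓ ∈ s.inp (Prod.fst '' X) →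
      (ℓ ∈ (par s e).inp X ∨ Obs.lab ℓ ∈ (par s e).out X) →
      GenCombinedTest s e ((par s e).after X [Obs.lab ℓ]) B →
      (∀ x ∈ contOutputs s e X, GenCombinedTest s e ((par s e).after X [Obs.lab x]) (R x)) →
      GenCombinedTest s e X
        ((Beh.seq (TLab.lab ℓ) B).choice (inputResponse s e X R))
  /-- observe quiescence that `s` forbids -/
  | quiescenceFail (X : Set (Q × Q')) (R : Λ → Beh (TLab Λ)) :
      Obs.delta ∉ s.out (Prod.fst '' X) →
      (∀ x ∈ contOutputs s e X, GenCombinedTest s e ((par s e).after X [Obs.lab x]) (R x)) →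
      GenCombinedTest s e X
        ((Beh.seq TLab.theta Beh.fail).choice (inputResponse s e X R))
  /-- observe quiescence that `s ∥ e` allows -/
  | quiescence (X : Set (Q × Q')) (B : Beh (TLab Λ)) (R : Λ → Beh (TLab Λ)) :
      Obs.delta ∈ s.out (Prod.fst '' X) →
      Obs.delta ∈ (par s e).out X →
      GenCombinedTest s e ((par s e).after X [Obs.delta]) B →
      (∀ x ∈ contOutputs s e X, GenCombinedTest s e ((par s e).after X [Obs.lab x]) (R x)) →
      GenCombinedTest s e X
        ((Beh.seq TLab.theta B).choice (inputResponse s e X R))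
  /-- observe quiescence that `s` allows but `s ∥ e` does not show -/
  | quiescenceLocal (X : Set (Q × Q')) (B : Beh (TLab Λ)) (R : Λ → Beh (TLab Λ)) :
      Obs.delta ∈ s.out (Prod.fst '' X) →
      Obs.delta ∉ (par s e).out X →
      GenCombinedTest s e X B →
      (∀ x ∈ contOutputs s e X, GenCombinedTest s e ((par s e).after X [Obs.lab x]) (R x)) →
      GenCombinedTest s e X
        ((Beh.seq TLab.thetaS B).choice (inputResponse s e X R))
  /-- simulate behaviour of the environment in which the system under test takes no part -/
  | environment (X : Set (Q × Q')) (ℓ : Λ) (B : Beh (TLab Λ)) (R : Λ → Beh (TLab Λ)) :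
      (Obs.lab ℓ ∈ (par s e).out X ∨ ℓ ∈ (par s e).inp X) →
      ℓ ∉ s.L →
      GenCombinedTest s e ((par s e).after X [Obs.lab ℓ]) B →
      (∀ x ∈ contOutputs s e X, GenCombinedTest s e ((par s e).after X [Obs.lab x]) (R x)) →
      GenCombinedTest s e X
        ((Beh.seq (TLab.lab ℓ) B).choice (inputResponse s e X R))

/-- Inputs of the test cases for `s` and `e`. -/
def testInputs (s : LTS Λ Q) : Set (TLab Λ) :=
  TLab.lab '' s.U ∪ {TLab.theta, TLab.thetaS}

/-- Outputs of the test cases for `s` and `e`. -/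
def testOutputs (s : LTS Λ Q) (e : LTS Λ Q') : Set (TLab Λ) :=
  TLab.lab '' (e.U ∪ (e.I \ s.U) ∪ (s.I \ e.L))

/-- The test case with initial state `B`. Since all behaviour expressions are taken as states,
those transitions are kept whose label is one of the test case. -/
def testLTS (s : LTS Λ Q) (e : LTS Λ Q') (h : Composable s e) (B : Beh (TLab Λ)) :
    LTS (TLab Λ) (Beh (TLab Λ)) where
  I := testInputs s
  U := testOutputs s e
  T := fun B₁ a B₂ => ∃ x, a = Act.lab x ∧ x ∈ testInputs s ∪ testOutputs s e ∧
    Beh.Step (testInputs s) B₁ x B₂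
  q0 := B
  disj := by
    have h1 := Set.disjoint_left.1 s.disj
    have h2 := Set.disjoint_left.1 h
    rw [Set.disjoint_left]
    rintro _ (⟨ℓ, hs, rfl⟩ | hx) ⟨m, hm, he⟩
    · obtain rfl : m = ℓ := by simpa using he
      rcases hm with (hm | hm) | hm
      · exact h2 hs hm
      · exact hm.2 hs
      · exact h1 hm.1 hs
    · rcases hx with rfl | rfl <;> cases he
  wf := by
    rintro _ ℓ _ ⟨x, hx, hm, -⟩
    cases hx
    exact hm

/-- The test suite of all test cases that the algorithm can generate for `s` and `e`. -/
def combinedTests (s : LTS Λ Q) (e : LTS Λ Q') (h : Composable s e) :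
    Set (LTS (TLab Λ) (Beh (TLab Λ))) :=
  {t | ∃ B, GenCombinedTest s e ((par s e).after {(par s e).q0} []) B ∧ t = testLTS s e h B}

end Gen

section Execution

variable {Λ : Type u} {Q : Type v} {P : Type w}

/-- Transition rules of test execution. -/
inductive ExecStep (t : LTS (TLab Λ) P) (i : LTS Λ Q) :
    P × Q → Act (TLab Λ) → P × Q → Prop
  | tau {p q q'} : i.T q Act.tau q' → ExecStep t i (p, q) Act.tau (p, q')
  | sut {p q q' ℓ} : i.T q (Act.lab ℓ) q' → TLab.lab ℓ ∉ t.L →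
      ExecStep t i (p, q) (Act.lab (TLab.lab ℓ)) (p, q')
  | test {p p' q ℓ} : t.T p (Act.lab (TLab.lab ℓ)) p' → ℓ ∉ i.L →
      ExecStep t i (p, q) (Act.lab (TLab.lab ℓ)) (p', q)
  | sync {p p' q q' ℓ} : t.T p (Act.lab (TLab.lab ℓ)) p' → i.T q (Act.lab ℓ) q' →
      ExecStep t i (p, q) (Act.lab (TLab.lab ℓ)) (p', q')
  | theta {p p' q q'} : t.T p (Act.lab TLab.theta) p' → i.Step q Obs.delta q' →
      ExecStep t i (p, q) (Act.lab TLab.theta) (p', q')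
  | thetaS {p p' q q'} : t.T p (Act.lab TLab.thetaS) p' → i.Step q Obs.delta q' →
      ExecStep t i (p, q) (Act.lab TLab.thetaS) (p', q')

/-- Execution of the test `t` on the system `i`. All labels, including those for observing
quiescence, count as outputs. -/
def testExec (t : LTS (TLab Λ) P) (i : LTS Λ Q) : LTS (TLab Λ) (P × Q) where
  I := ∅
  U := TLab.lab '' i.L ∪ t.L
  T := ExecStep t i
  q0 := (t.q0, i.q0)
  disj := Set.empty_disjoint _
  wf := by
    intro _ x _ h
    refine Or.inr ?_
    cases h with
    | sut h _ => exact Or.inl ⟨_, i.wf _ _ _ h, rfl⟩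
    | test h _ => exact Or.inr (t.wf _ _ _ h)
    | sync h _ => exact Or.inr (t.wf _ _ _ h)
    | theta h _ => exact Or.inr (t.wf _ _ _ h)
    | thetaS h _ => exact Or.inr (t.wf _ _ _ h)

/-- The traces (without quiescence as a label) of the execution that reach a terminal state. -/
def testRuns (t : LTS (TLab Λ) (Beh (TLab Λ))) (i : LTS Λ Q) : Set (List (TLab Λ)) :=
  {σ | ∃ q, (testExec t i).Weak (testExec t i).q0 (σ.map Obs.lab) (Beh.pass, q) ∨
    (testExec t i).Weak (testExec t i).q0 (σ.map Obs.lab) (Beh.fail, q)}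

/-- No test run reaches the failing state. -/
def Passes (i : LTS Λ Q) (t : LTS (TLab Λ) (Beh (TLab Λ))) : Prop :=
  ∀ σ ∈ testRuns t i, ∀ q,
    ¬ (testExec t i).Weak (testExec t i).q0 (σ.map Obs.lab) (Beh.fail, q)

/-- All tests of the suite pass. -/
def PassesSuite (i : LTS Λ Q) (TS : Set (LTS (TLab Λ) (Beh (TLab Λ)))) : Prop :=
  ∀ t ∈ TS, Passes i t

end Execution

end CompTest

/-!
Fix a utrace `σ` of `s ∥ e` and let `X` be the set of states of `s ∥ e` after `σ`.

*Following `σ` by tests.* Suppose that `i_s ∥ i_e` performs `σ` and reaches `(q, r)`. Then no test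
generated from `X` can fail when it is started in the state `q` of `i_s`, and likewise for `r` and
the tests generated for `(e, s)`; this is `Safe`. It is shown by induction on `σ`: were there a
failing test for the state after the next label, then prefixing it by that label would give a
failing test for the state before. The algorithm allows this prefix. For a shared output of `e`
it demands that `s` accepts the label in every state of `X`, and it is the tests of `i_e` that
guarantee this, because a test for `(e, s)` fails on an output that `s` may refuse
(`Safe.output` and `Safe.par_step`). A quiescent state of `i_s ∥ i_e` has both components
quiescent, because both are input-enabled (`quiescent_of_par_quiescent`).

*Outputs.* If `q` has an output outside `out X`, then the test that merely observes fails on it.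

*Quiescence.* If `q` and `r` are both quiescent, then the tests only give a pair in `X` with
quiescent left component and a pair in `X` with quiescent right component. Utrace-closedness makes
`X` rectangular (`rectangular_after`), so that these two components can be combined to a quiescent
state in `X`. The delicate point is a quiescence step in `σ`: a state of `s ∥ e` may be quiescent
although `s` has an output, which `e` refuses. In a utrace-closed system the states
reached by one trace accept the same inputs (`canWeak_of_confined`), so which outputs are refused
does not depend on the state of the partner (`BlockedBy.congr_right`), and the set of quiescent
pairs remains rectangular.
-/

namespace CompTest

variable {Λ : Type*} {Q Q' P P' : Type*}

/-! ### Weak transitions -/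

namespace LTS

theorem Weak.trans_eps {s : LTS Λ Q} {σ : List (Obs Λ)} {q q₁ q₂ : Q}
    (h : s.Weak q σ q₁) (h' : s.Eps q₁ q₂) : s.Weak q σ q₂ := by
  induction σ generalizing q with
  | nil => exact Relation.ReflTransGen.trans h h'
  | cons x σ ih =>
    obtain ⟨a, b, h1, h2, h3⟩ := h
    exact ⟨a, b, h1, h2, ih h3⟩

theorem Step.weak {s : LTS Λ Q} {x : Obs Λ} {q q' : Q} (h : s.Step q x q') : s.Weak q [x] q' :=
  ⟨q, q', .refl, h, .refl⟩

theorem mem_after_q0 {s : LTS Λ Q} {σ : List (Obs Λ)} {q : Q} :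
    q ∈ s.after {s.q0} σ ↔ s.Weak s.q0 σ q := by
  simp [after]

theorem after_append_singleton (s : LTS Λ Q) (X : Set Q) (σ : List (Obs Λ)) (x : Obs Λ) :
    s.after X (σ ++ [x]) = s.after (s.after X σ) [x] := by
  ext q'
  constructor
  · rintro ⟨q, hq, h⟩
    obtain ⟨a, b, h1, h2, h3⟩ := (s.weak_snoc ..).1 h
    exact ⟨a, ⟨q, hq, h1⟩, a, b, .refl, h2, h3⟩
  · rintro ⟨q₁, ⟨q, hq, h⟩, a, b, h1, h2, h3⟩
    exact ⟨q, hq, (s.weak_snoc ..).2 ⟨a, b, h.trans_eps h1, h2, h3⟩⟩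

theorem eps_eq_of_no_tau {s : LTS Λ Q} {q q' : Q} (hq : ∀ q', ¬ s.T q Act.tau q')
    (h : s.Eps q q') : q' = q := by
  rcases Relation.ReflTransGen.cases_head h with h | ⟨a, h, -⟩
  · exact h.symm
  · exact absurd h (hq a)

theorem exists_step_of_canWeak {s : LTS Λ Q} {q : Q} {ℓ : Λ} (hq : ∀ q', ¬ s.T q Act.tau q')
    (h : s.CanWeak q [Obs.lab ℓ]) : ∃ q', s.T q (Act.lab ℓ) q' := by
  obtain ⟨_, a, b, h1, h2, -⟩ := h
  obtain rfl := eps_eq_of_no_tau hq h1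
  exact ⟨b, h2⟩

theorem utraces_of_append {s : LTS Λ Q} {σ : List (Obs Λ)} {x : Obs Λ}
    (h : σ ++ [x] ∈ s.Utraces) : σ ∈ s.Utraces := by
  obtain ⟨⟨q, hq⟩, h⟩ := h
  obtain ⟨a, b, h1, -, -⟩ := (s.weak_snoc ..).1 hq
  refine ⟨⟨a, h1⟩, fun q σ₁ ℓ σ₂ hσ => h q σ₁ ℓ (σ₂ ++ [x]) ?_⟩
  simp [← hσ]

/-- The last label of a utrace is an output, or an input that no state refuses. -/
theorem mem_out_or_mem_inp_of_utrace {s : LTS Λ Q} {σ : List (Obs Λ)} {ℓ : Λ}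
    (h : σ ++ [Obs.lab ℓ] ∈ s.Utraces) :
    Obs.lab ℓ ∈ s.out (s.after {s.q0} σ) ∨ ℓ ∈ s.inp (s.after {s.q0} σ) := by
  obtain ⟨⟨q, hq⟩, h⟩ := h
  obtain ⟨a, b, h1, h2, -⟩ := (s.weak_snoc ..).1 hq
  rcases s.wf _ _ _ h2 with hI | hU
  · exact Or.inr ⟨hI, fun q hq => h q σ ℓ [] rfl hI (mem_after_q0.1 hq)⟩
  · exact Or.inl ⟨Or.inr ⟨ℓ, hU, rfl⟩, a, mem_after_q0.2 h1, b, h2⟩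

theorem delta_mem_out_of_utrace {s : LTS Λ Q} {σ : List (Obs Λ)}
    (h : σ ++ [Obs.delta] ∈ s.Utraces) : Obs.delta ∈ s.out (s.after {s.q0} σ) := by
  obtain ⟨⟨q, hq⟩, -⟩ := h
  obtain ⟨a, b, h1, h2, -⟩ := (s.weak_snoc ..).1 hq
  exact ⟨Or.inl rfl, a, mem_after_q0.2 h1, b, h2⟩

theorem not_mem_I_of_mem_U {s : LTS Λ Q} {ℓ : Λ} (h : ℓ ∈ s.U) : ℓ ∉ s.I :=
  fun h' => Set.disjoint_left.1 s.disj h' h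

/-- All states in `A` can be reached by one and the same trace. -/
def Confined (s : LTS Λ Q) (A : Set Q) : Prop := ∃ σ, A ⊆ s.after {s.q0} σ

theorem canWeak_of_confined {s : LTS Λ Q} (hs : s.UtraceClosed) {A : Set Q} (hA : s.Confined A)
    {p p' : Q} (hp : p ∈ A) (hp' : p' ∈ A) {ℓ : Λ} (hℓ : ℓ ∈ s.I)
    (h : s.CanWeak p [Obs.lab ℓ]) : s.CanWeak p' [Obs.lab ℓ] := by
  obtain ⟨σ, hσ⟩ := hA
  obtain ⟨q, a, b, h1, h2, h3⟩ := h
  have hw : s.CanWeak s.q0 (σ ++ [Obs.lab ℓ]) :=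
    ⟨q, (s.weak_snoc ..).2 ⟨a, b, (mem_after_q0.1 (hσ hp)).trans_eps h1, h2, h3⟩⟩
  exact (hs _ hw).2 p' σ ℓ [] rfl hℓ (mem_after_q0.1 (hσ hp'))

/-- The part of a component `s` in a weak transition with label `ℓ` of a parallel composition:
it takes part in the label if it knows it, and performs internal transitions only otherwise. -/
def Move (s : LTS Λ Q) (ℓ : Λ) (p p' : Q) : Prop :=
  (ℓ ∈ s.L ∧ s.Weak p [Obs.lab ℓ] p') ∨ (ℓ ∉ s.L ∧ s.Eps p p')

theorem Confined.of_move {s : LTS Λ Q} {A B : Set Q} {ℓ : Λ} (hA : s.Confined A)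
    (h : ∀ b ∈ B, ∃ a ∈ A, s.Move ℓ a b) : s.Confined B := by
  obtain ⟨σ, hσ⟩ := hA
  by_cases hℓ : ℓ ∈ s.L
  · refine ⟨σ ++ [Obs.lab ℓ], fun b hb => ?_⟩
    obtain ⟨a, ha, ⟨-, hm⟩ | ⟨hm, -⟩⟩ := h b hb
    · rw [after_append_singleton]
      exact ⟨a, hσ ha, hm⟩
    · exact absurd hℓ hm
  · refine ⟨σ, fun b hb => ?_⟩
    obtain ⟨a, ha, ⟨hm, -⟩ | ⟨-, hm⟩⟩ := h b hb
    · exact absurd hm hℓ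
    · exact mem_after_q0.2 ((mem_after_q0.1 (hσ ha)).trans_eps hm)

theorem InputEnabled.exists_move {s : LTS Λ Q} (hs : s.InputEnabled) {ℓ : Λ} (hU : ℓ ∉ s.U)
    (q : Q) : ∃ q', s.Move ℓ q q' := by
  by_cases hI : ℓ ∈ s.I
  · obtain ⟨q', hq'⟩ := hs q ℓ hI
    exact ⟨q', .inl ⟨.inl hI, hq'⟩⟩
  · exact ⟨q, .inr ⟨not_or.2 ⟨hI, hU⟩, .refl⟩⟩

end LTS

open LTS

/-! ### Weak transitions of parallel compositions -/

section Par

variable {s : LTS Λ Q} {e : LTS Λ Q'}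

theorem par_eps_iff {x y : Q × Q'} :
    (par s e).Eps x y ↔ s.Eps x.1 y.1 ∧ e.Eps x.2 y.2 := by
  constructor
  · intro h
    induction h with
    | refl => exact ⟨.refl, .refl⟩
    | tail _ h ih =>
      cases h with
      | left_tau h => exact ⟨ih.1.tail h, ih.2⟩
      | right_tau h => exact ⟨ih.1, ih.2.tail h⟩
  · obtain ⟨p, r⟩ := x
    obtain ⟨p', r'⟩ := y
    rintro ⟨h1, h2⟩
    have h1' : (par s e).Eps (p, r) (p', r) :=
      Relation.ReflTransGen.lift (fun a => (a, r)) (fun _ _ h => ParStep.left_tau h) _ _ h1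
    have h2' : (par s e).Eps (p', r) (p', r') :=
      Relation.ReflTransGen.lift (fun a => (p', a)) (fun _ _ h => ParStep.right_tau h) _ _ h2
    exact Relation.ReflTransGen.trans h1' h2'

theorem par_weak_lab_iff {x y : Q × Q'} {ℓ : Λ} :
    (par s e).Weak x [Obs.lab ℓ] y ↔
      (ℓ ∈ s.L ∨ ℓ ∈ e.L) ∧ s.Move ℓ x.1 y.1 ∧ e.Move ℓ x.2 y.2 := by
  obtain ⟨p, r⟩ := x
  obtain ⟨p', r'⟩ := y
  constructor
  · rintro ⟨⟨a, c⟩, ⟨b, d⟩, h1, h2, h3⟩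
    obtain ⟨h1, h1'⟩ := par_eps_iff.1 h1
    obtain ⟨h3, h3'⟩ := par_eps_iff.1 h3
    cases h2 with
    | left h hn =>
      exact ⟨.inl (s.wf _ _ _ h), .inl ⟨s.wf _ _ _ h, a, b, h1, h, h3⟩,
        .inr ⟨hn, Relation.ReflTransGen.trans h1' h3'⟩⟩
    | right h hn =>
      exact ⟨.inr (e.wf _ _ _ h), .inr ⟨hn, Relation.ReflTransGen.trans h1 h3⟩,
        .inl ⟨e.wf _ _ _ h, c, d, h1', h, h3'⟩⟩
    | sync h h' =>
      exact ⟨.inl (s.wf _ _ _ h), .inl ⟨s.wf _ _ _ h, a, b, h1, h, h3⟩,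
        .inl ⟨e.wf _ _ _ h', c, d, h1', h', h3'⟩⟩
  · rintro ⟨hℓ, ⟨-, a, b, h1, h2, h3⟩ | ⟨hn, h1⟩, ⟨-, c, d, h1', h2', h3'⟩ | ⟨hn', h1'⟩⟩
    · exact ⟨(a, c), (b, d), par_eps_iff.2 ⟨h1, h1'⟩, ParStep.sync h2 h2', par_eps_iff.2 ⟨h3, h3'⟩⟩
    · exact ⟨(a, r'), (b, r'), par_eps_iff.2 ⟨h1, h1'⟩, ParStep.left h2 hn',
        par_eps_iff.2 ⟨h3, .refl⟩⟩
    · exact ⟨(p', c), (p', d), par_eps_iff.2 ⟨h1, h1'⟩, ParStep.right h2' hn,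
        par_eps_iff.2 ⟨.refl, h3'⟩⟩
    · exact absurd hℓ (not_or.2 ⟨hn, hn'⟩)

theorem par_inputEnabled (hs : s.InputEnabled) (he : e.InputEnabled) :
    (par s e).InputEnabled := by
  rintro ⟨p, r⟩ ℓ hℓ
  have hU : ℓ ∉ s.U ∧ ℓ ∉ e.U := not_or.1 fun hU => Set.disjoint_left.1 (par s e).disj hℓ hU
  obtain ⟨p', hp⟩ := hs.exists_move hU.1 p
  obtain ⟨r', hr⟩ := he.exists_move hU.2 r
  refine ⟨(p', r'), par_weak_lab_iff.2 ⟨?_, hp, hr⟩⟩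
  exact hℓ.imp (fun h => .inl h.1) fun h => .inl h.1

theorem inp_fst_of_inp_par {X : Set (Q × Q')} {ℓ : Λ} (h : ℓ ∈ (par s e).inp X) (hs : ℓ ∈ s.L) :
    ℓ ∈ s.inp (Prod.fst '' X) := by
  have hU : ℓ ∉ s.U := fun hU => Set.disjoint_left.1 (par s e).disj h.1 (.inl hU)
  refine ⟨hs.resolve_right hU, ?_⟩
  rintro _ ⟨x, hx, rfl⟩
  obtain ⟨y, hy⟩ := h.2 x hx
  obtain ⟨-, hw | hw, -⟩ := par_weak_lab_iff.1 hy
  · exact ⟨y.1, hw.2⟩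
  · exact absurd hs hw.1

/-! ### Exchanging the components -/

theorem parStep_swap {x y : Q × Q'} {a : Act Λ} (h : ParStep s e x a y) :
    ParStep e s x.swap a y.swap := by
  cases h with
  | left_tau h => exact .right_tau h
  | left h hn => exact .right h hn
  | right_tau h => exact .left_tau h
  | right h hn => exact .left h hn
  | sync h h' => exact .sync h' h

theorem par_step_swap {x y : Q × Q'} {a : Obs Λ} (h : (par s e).Step x a y) :
    (par e s).Step x.swap a y.swap := by
  cases a with
  | delta =>
    obtain ⟨rfl, h1, h2⟩ := h
    exact ⟨rfl, fun z hz => h1 _ (parStep_swap hz),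
      fun ℓ hℓ z hz => h2 ℓ hℓ.symm _ (parStep_swap hz)⟩
  | lab ℓ => exact parStep_swap h

theorem par_weak_swap {x y : Q × Q'} {σ : List (Obs Λ)} (h : (par s e).Weak x σ y) :
    (par e s).Weak x.swap σ y.swap := by
  induction σ generalizing x with
  | nil => exact par_eps_iff.2 (par_eps_iff.1 h).symm
  | cons a σ ih =>
    obtain ⟨z, z', h1, h2, h3⟩ := h
    exact ⟨z.swap, z'.swap, par_eps_iff.2 (par_eps_iff.1 h1).symm, par_step_swap h2, ih h3⟩

theorem par_after_swap (X : Set (Q × Q')) (σ : List (Obs Λ)) :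
    (par e s).after (Prod.swap '' X) σ = Prod.swap '' (par s e).after X σ := by
  ext y
  constructor
  · rintro ⟨_, ⟨x, hx, rfl⟩, h⟩
    exact ⟨y.swap, ⟨x, hx, par_weak_swap h⟩, rfl⟩
  · rintro ⟨y, ⟨x, hx, h⟩, rfl⟩
    exact ⟨x.swap, ⟨x, hx, rfl⟩, par_weak_swap h⟩

theorem par_out_swap {X : Set (Q × Q')} {a : Obs Λ} (h : a ∈ (par s e).out X) :
    a ∈ (par e s).out (Prod.swap '' X) := by
  obtain ⟨ha, x, hx, y, hy⟩ := h
  exact ⟨ha.imp id fun ⟨ℓ, hℓ, h⟩ => ⟨ℓ, hℓ.symm, h⟩, x.swap, ⟨x, hx, rfl⟩, y.swap,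
    par_step_swap hy⟩

theorem par_inp_swap {X : Set (Q × Q')} {ℓ : Λ} (h : ℓ ∈ (par s e).inp X) :
    ℓ ∈ (par e s).inp (Prod.swap '' X) := by
  refine ⟨h.1.symm, ?_⟩
  rintro _ ⟨x, hx, rfl⟩
  obtain ⟨y, hy⟩ := h.2 x hx
  exact ⟨y.swap, par_weak_swap hy⟩

theorem snd_image_swap (X : Set (Q × Q')) : Prod.snd '' (Prod.swap '' X) = Prod.fst '' X := by
  simp [Set.image_image]

theorem swap_image_swap (X : Set (Q × Q')) : Prod.swap '' (Prod.swap '' X) = X := by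
  simp [Set.image_image]

/-! ### Quiescence of parallel compositions -/

/-- The contribution of `s` to the quiescence of `(p, r)` in `s ∥ e`: there is no internal
transition from `p`, and every output of `p` is an input of `e` that `r` refuses. -/
def BlockedBy (s : LTS Λ Q) (e : LTS Λ Q') (p : Q) (r : Q') : Prop :=
  (∀ p', ¬ s.T p Act.tau p') ∧
    ∀ ℓ ∈ s.U, ∀ p', s.T p (Act.lab ℓ) p' → ℓ ∈ e.I ∧ ¬ e.CanWeak r [Obs.lab ℓ]

theorem blockedBy_of_quiescent {p : Q} (hp : s.Quiescent p) (r : Q') : BlockedBy s e p r :=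
  ⟨hp.1, fun ℓ hℓ p' h => absurd h (hp.2 ℓ hℓ p')⟩

theorem blockedBy_of_par_quiescent (h : Composable s e) {p : Q} {r : Q'}
    (hq : (par s e).Quiescent (p, r)) : BlockedBy s e p r := by
  refine ⟨fun p' hp => hq.1 _ (.left_tau hp), fun ℓ hℓ p' hp => ?_⟩
  have hL : ℓ ∈ e.L := by
    by_contra hL
    exact hq.2 ℓ (.inl hℓ) _ (.left hp hL)
  refine ⟨hL.resolve_right (Set.disjoint_left.1 h hℓ), fun hr => ?_⟩
  obtain ⟨r', hr⟩ := exists_step_of_canWeak (fun r' hr => hq.1 _ (.right_tau hr)) hr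
  exact hq.2 ℓ (.inl hℓ) _ (.sync hp hr)

theorem par_quiescent_iff (h : Composable s e) {p : Q} {r : Q'} :
    (par s e).Quiescent (p, r) ↔ BlockedBy s e p r ∧ BlockedBy e s r p := by
  constructor
  · intro hq
    refine ⟨blockedBy_of_par_quiescent h hq, blockedBy_of_par_quiescent h.symm ?_⟩
    exact (par_step_swap (a := .delta) ⟨rfl, hq⟩).2
  · rintro ⟨⟨h1, h2⟩, h3, h4⟩
    constructor
    · rintro _ (h | _ | h | _ | _)
      · exact h1 _ h
      · exact h3 _ h
    · rintro ℓ hℓ _ (_ | ⟨hp, hn⟩ | _ | ⟨hr, hn⟩ | ⟨hp, hr⟩)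
      · rcases hℓ with hℓ | hℓ
        · exact hn (.inl (h2 ℓ hℓ _ hp).1)
        · exact hn (.inr hℓ)
      · rcases hℓ with hℓ | hℓ
        · exact hn (.inr hℓ)
        · exact hn (.inl (h4 ℓ hℓ _ hr).1)
      · rcases hℓ with hℓ | hℓ
        · exact (h2 ℓ hℓ _ hp).2 ⟨_, Step.weak hr⟩
        · exact (h4 ℓ hℓ _ hr).2 ⟨_, Step.weak hp⟩

theorem quiescent_of_par_quiescent (h : Composable s e) (he : e.InputEnabled) {p : Q} {r : Q'}
    (hq : (par s e).Quiescent (p, r)) : s.Quiescent p := by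
  obtain ⟨h1, h2⟩ := blockedBy_of_par_quiescent h hq
  refine ⟨h1, fun ℓ hℓ p' hp => ?_⟩
  obtain ⟨hI, hn⟩ := h2 ℓ hℓ p' hp
  exact hn (he r ℓ hI)

theorem BlockedBy.congr_right (he : e.UtraceClosed) {A : Set Q'} (hA : e.Confined A) {p : Q}
    {r r' : Q'} (hr : r ∈ A) (hr' : r' ∈ A) (h : BlockedBy s e p r) : BlockedBy s e p r' := by
  refine ⟨h.1, fun ℓ hℓ p' hp => ?_⟩
  obtain ⟨hI, hn⟩ := h.2 ℓ hℓ p' hp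
  exact ⟨hI, fun hw => hn (canWeak_of_confined he hA hr' hr hI hw)⟩

/-- `X` is a product of a set of states of `s` and a set of states of `e`. -/
def Rectangular (X : Set (Q × Q')) : Prop :=
  ∀ x ∈ X, ∀ y ∈ X, (x.1, y.2) ∈ X

/-- The projections of `(s ∥ e) after σ` need not be of the form `s after σ₁` and `e after σ₂`
with the `δ`s of `σ` kept, because a quiescent pair may have components that are not quiescent.
That they are contained in such sets without the `δ`s is enough to carry rectangularity through
the induction. -/
theorem rectangular_after (h : Composable s e) (hs : s.UtraceClosed) (he : e.UtraceClosed)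
    (σ : List (Obs Λ)) :
    Rectangular ((par s e).after {(par s e).q0} σ) ∧
      s.Confined (Prod.fst '' (par s e).after {(par s e).q0} σ) ∧
      e.Confined (Prod.snd '' (par s e).after {(par s e).q0} σ) := by
  induction σ using List.reverseRecOn with
  | nil =>
    refine ⟨fun x hx y hy => ?_, ⟨[], ?_⟩, ⟨[], ?_⟩⟩
    · exact mem_after_q0.2 (par_eps_iff.2
        ⟨(par_eps_iff.1 (mem_after_q0.1 hx)).1, (par_eps_iff.1 (mem_after_q0.1 hy)).2⟩)
    · rintro _ ⟨x, hx, rfl⟩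
      exact mem_after_q0.2 (par_eps_iff.1 (mem_after_q0.1 hx)).1
    · rintro _ ⟨x, hx, rfl⟩
      exact mem_after_q0.2 (par_eps_iff.1 (mem_after_q0.1 hx)).2
  | append_singleton σ a ih =>
    obtain ⟨hX, h1, h2⟩ := ih
    cases a with
    | delta =>
      have key : (par s e).after {(par s e).q0} (σ ++ [Obs.delta]) =
          {x ∈ (par s e).after {(par s e).q0} σ | (par s e).Quiescent x} := by
        ext x
        rw [mem_after_q0, weak_snoc]
        constructor
        · rintro ⟨a, b, ha, ⟨rfl, hq⟩, hb⟩
          obtain rfl := eps_eq_of_no_tau hq.1 hb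
          exact ⟨mem_after_q0.2 ha, hq⟩
        · rintro ⟨hx, hq⟩
          exact ⟨x, x, mem_after_q0.1 hx, ⟨rfl, hq⟩, .refl⟩
      rw [key]
      set X := (par s e).after {(par s e).q0} σ
      refine ⟨?_, h1.imp fun σ hσ => .trans (Set.image_mono fun x hx => hx.1) hσ,
        h2.imp fun σ hσ => .trans (Set.image_mono fun x hx => hx.1) hσ⟩
      rintro ⟨p, r⟩ ⟨hx, hq⟩ ⟨p', r'⟩ ⟨hx', hq'⟩
      have b := ((par_quiescent_iff h).1 hq).1
      have b' := ((par_quiescent_iff h).1 hq').2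
      exact ⟨hX _ hx _ hx', (par_quiescent_iff h).2
        ⟨b.congr_right he h2 ⟨_, hx, rfl⟩ ⟨_, hx', rfl⟩,
          b'.congr_right hs h1 ⟨_, hx', rfl⟩ ⟨_, hx, rfl⟩⟩⟩
    | lab ℓ =>
      rw [after_append_singleton]
      set X := (par s e).after {(par s e).q0} σ
      refine ⟨?_, h1.of_move (ℓ := ℓ) ?_, h2.of_move (ℓ := ℓ) ?_⟩
      · rintro x ⟨x₀, hx₀, hx⟩ y ⟨y₀, hy₀, hy⟩
        obtain ⟨hℓ, hx, -⟩ := par_weak_lab_iff.1 hx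
        obtain ⟨-, -, hy⟩ := par_weak_lab_iff.1 hy
        exact ⟨(x₀.1, y₀.2), hX _ hx₀ _ hy₀, par_weak_lab_iff.2 ⟨hℓ, hx, hy⟩⟩
      · rintro _ ⟨x, ⟨x₀, hx₀, hx⟩, rfl⟩
        exact ⟨_, ⟨x₀, hx₀, rfl⟩, (par_weak_lab_iff.1 hx).2.1⟩
      · rintro _ ⟨x, ⟨x₀, hx₀, hx⟩, rfl⟩
        exact ⟨_, ⟨x₀, hx₀, rfl⟩, (par_weak_lab_iff.1 hx).2.2⟩

end Par

/-! ### Transitions of tests -/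

namespace Beh

variable {M : Type*} {It : Set M} {A B C : Beh M} {x : M}

theorem Step.choice_left (h : Step It A x C) : Step It (A.choice B) x C :=
  .sum (i := ⟨true⟩) (by simpa using h)

theorem Step.choice_right (h : Step It B x C) : Step It (A.choice B) x C :=
  .sum (i := ⟨false⟩) (by simpa using h)

theorem Step.sumOver {It : Set (TLab Λ)} {S : Set Λ} {F : Λ → Beh (TLab Λ)} {ℓ : Λ} (h : ℓ ∈ S) :
    Step It (Beh.sumOver S F) (TLab.lab ℓ) (F ℓ) :=
  .sum (i := ⟨ℓ, h⟩) .seq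

end Beh

section Tests

variable {s : LTS Λ Q} {e : LTS Λ Q'} {i : LTS Λ P} {h : Composable s e} {X : Set (Q × Q')}

theorem inputResponse_step_of_refused {It : Set (TLab Λ)} {R : Λ → Beh (TLab Λ)} {ℓ : Λ}
    (hs : ℓ ∈ s.U) (he : ℓ ∈ e.I) (hℓ : ℓ ∉ e.inp (Prod.snd '' X)) :
    Beh.Step It (inputResponse s e X R) (TLab.lab ℓ) Beh.fail :=
  .choice_left (.choice_left (.sumOver (F := fun _ => Beh.fail) ⟨⟨hs, he⟩, hℓ⟩))

theorem inputResponse_step_of_not_out {It : Set (TLab Λ)} {R : Λ → Beh (TLab Λ)} {ℓ : Λ}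
    (hs : ℓ ∈ s.U) (hℓ : Obs.lab ℓ ∉ (par s e).out X) :
    Beh.Step It (inputResponse s e X R) (TLab.lab ℓ) Beh.fail :=
  .choice_left (.choice_right (.sumOver (F := fun _ => Beh.fail) ⟨hs, hℓ⟩))

theorem inputResponse_step_of_contOutputs {It : Set (TLab Λ)} {R : Λ → Beh (TLab Λ)} {ℓ : Λ}
    (hℓ : ℓ ∈ contOutputs s e X) :
    Beh.Step It (inputResponse s e X R) (TLab.lab ℓ) (R ℓ) := by
  obtain ⟨h1, h2 | h2, h3⟩ := hℓ
  · exact .choice_right (.choice_left (.sumOver ⟨h1, h2, h3⟩))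
  · exact .choice_right (.choice_right (.sumOver ⟨h1, h2, h3⟩))

/-- From every set of states a test can be generated that observes the system under test. -/
theorem exists_observing_test (R : Λ → Beh (TLab Λ))
    (hR : ∀ x ∈ contOutputs s e X, GenCombinedTest s e ((par s e).after X [Obs.lab x]) (R x)) :
    ∃ A, GenCombinedTest s e X (Beh.choice A (inputResponse s e X R)) := by
  by_cases h1 : Obs.delta ∈ s.out (Prod.fst '' X)
  · by_cases h2 : Obs.delta ∈ (par s e).out X
    · exact ⟨_, .quiescence X Beh.pass R h1 h2 (.halt _) hR⟩
    · exact ⟨_, .quiescenceLocal X Beh.pass R h1 h2 (.halt _) hR⟩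
  · exact ⟨_, .quiescenceFail X R h1 hR⟩

/-! ### Failing test executions -/

/-- Some execution on `i` of the test `B` for `s` and `e`, started in the state `q` of `i`,
reaches the failing state. The transitions of an execution do not depend on the initial state of
the test, so that `Beh.pass` can stand for it. -/
def CanFail (s : LTS Λ Q) (e : LTS Λ Q') (h : Composable s e) (i : LTS Λ P)
    (B : Beh (TLab Λ)) (q : P) : Prop :=
  ∃ q', Relation.ReflTransGen
    (fun y z => ∃ a, ExecStep (testLTS s e h Beh.pass) i y a z) (B, q) (Beh.fail, q')

theorem canFail_fail (q : P) : CanFail s e h i Beh.fail q := ⟨q, .refl⟩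

theorem CanFail.of_eps {B : Beh (TLab Λ)} {q q' : P} (hq : i.Eps q q')
    (hf : CanFail s e h i B q') : CanFail s e h i B q := by
  obtain ⟨p, hp⟩ := hf
  exact ⟨p, .trans (Relation.ReflTransGen.lift (fun a => (B, a))
    (fun _ _ h => ⟨_, ExecStep.tau h⟩) _ _ hq) hp⟩

theorem CanFail.of_step {B B' : Beh (TLab Λ)} {q q' : P} {a : Act (TLab Λ)}
    (hx : ExecStep (testLTS s e h Beh.pass) i (B, q) a (B', q'))
    (hf : CanFail s e h i B' q') : CanFail s e h i B q := by
  obtain ⟨p, hp⟩ := hf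
  exact ⟨p, .head ⟨a, hx⟩ hp⟩

theorem CanFail.not_passes {B : Beh (TLab Λ)} (hf : CanFail s e h i B i.q0) :
    ¬ Passes i (testLTS s e h B) := by
  have step_eq {y z a} (hy : ExecStep (testLTS s e h Beh.pass) i y a z) :
      ExecStep (testLTS s e h B) i y a z := by
    cases hy with
    | tau h => exact .tau h
    | sut h hn => exact .sut h hn
    | test h hn => exact .test h hn
    | sync h h' => exact .sync h h'
    | theta h h' => exact .theta h h'
    | thetaS h h' => exact .thetaS h h'
  obtain ⟨p, hp⟩ := hf
  obtain ⟨σ, hσ⟩ : ∃ σ : List (TLab Λ),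
      (testExec (testLTS s e h B) i).Weak (B, i.q0) (σ.map Obs.lab) (Beh.fail, p) := by
    generalize (B, i.q0) = y at hp ⊢
    induction hp using Relation.ReflTransGen.head_induction_on with
    | refl => exact ⟨[], Relation.ReflTransGen.refl⟩
    | head hy _ ih =>
      obtain ⟨a, hy⟩ := hy
      obtain ⟨σ, hσ⟩ := ih
      cases a with
      | tau =>
        refine ⟨σ, ?_⟩
        cases σ with
        | nil => exact Relation.ReflTransGen.head (step_eq hy) hσ
        | cons x σ =>
          obtain ⟨b, c, h1, h2⟩ := hσ
          exact ⟨b, c, Relation.ReflTransGen.head (step_eq hy) h1, h2⟩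
      | lab x => exact ⟨x :: σ, _, _, Relation.ReflTransGen.refl, step_eq hy, hσ⟩
  exact fun hB => hB σ ⟨p, .inr hσ⟩ p hσ

/-! ### States in which no generated test fails -/

/-- No test generated from the set `X` of states of `s ∥ e` can fail on `i` when it is started in
the state `q` of `i`. -/
def Safe (s : LTS Λ Q) (e : LTS Λ Q') (h : Composable s e) (i : LTS Λ P) (X : Set (Q × Q'))
    (q : P) : Prop :=
  ∀ B, GenCombinedTest s e X B → ¬ CanFail s e h i B q

theorem safe_of_passesSuite (hp : PassesSuite i (combinedTests s e h)) :
    Safe s e h i ((par s e).after {(par s e).q0} []) i.q0 :=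
  fun B hB hf => hf.not_passes (hp _ ⟨B, hB, rfl⟩)

theorem Safe.of_eps {q q' : P} (hq : Safe s e h i X q) (hE : i.Eps q q') : Safe s e h i X q' :=
  fun B hB hf => hq B hB (hf.of_eps hE)

/-- An output of a safe state is among those after which the tests are continued. -/
theorem Safe.output {q q' : P} {ℓ : Λ} (hq : Safe s e h i X q) (hℓ : ℓ ∈ s.U)
    (hT : i.T q (Act.lab ℓ) q') :
    ℓ ∈ contOutputs s e X ∧ Safe s e h i ((par s e).after X [Obs.lab ℓ]) q' := by
  have step {A B : Beh (TLab Λ)} {R : Λ → Beh (TLab Λ)}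
      (hB : Beh.Step (testInputs s) (inputResponse s e X R) (TLab.lab ℓ) B) :
      ExecStep (testLTS s e h Beh.pass) i (A.choice (inputResponse s e X R), q)
        (Act.lab (TLab.lab ℓ)) (B, q') :=
    .sync ⟨_, rfl, .inl (.inl ⟨ℓ, hℓ, rfl⟩), .choice_right hB⟩ hT
  have hc : ℓ ∈ contOutputs s e X := by
    obtain ⟨A, hA⟩ := exists_observing_test (s := s) (e := e) (X := X) (fun _ => Beh.pass)
      fun _ _ => .halt _
    have no_fail := fun hB => hq _ hA ((canFail_fail q').of_step (step hB))
    refine ⟨hℓ, ?_, ?_⟩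
    · by_contra! hn
      have hI : ℓ ∈ e.I := hn.2.resolve_right (Set.disjoint_left.1 h hℓ)
      exact no_fail (inputResponse_step_of_refused hℓ hI hn.1)
    · by_contra hn
      exact no_fail (inputResponse_step_of_not_out hℓ hn)
  refine ⟨hc, fun B hB hf => ?_⟩
  classical
  obtain ⟨A, hA⟩ := exists_observing_test (s := s) (e := e) (X := X)
    (Function.update (fun _ => Beh.pass) ℓ B) fun x _ => by
      by_cases hx : x = ℓ
      · subst hx
        simpa using hB
      · simpa [hx] using .halt _
  refine hq _ hA (hf.of_step (step ?_))
  simpa using inputResponse_step_of_contOutputs (It := testInputs s)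
    (R := Function.update (fun _ => Beh.pass) ℓ B) hc

theorem Safe.input {q q' : P} {ℓ : Λ} (hq : Safe s e h i X q)
    (hℓ : ℓ ∈ s.inp (Prod.fst '' X))
    (hX : Obs.lab ℓ ∈ (par s e).out X ∨ ℓ ∈ (par s e).inp X)
    (hT : i.T q (Act.lab ℓ) q') :
    Safe s e h i ((par s e).after X [Obs.lab ℓ]) q' := by
  intro B hB hf
  have hU : ℓ ∈ e.U ∪ (e.I \ s.U) ∪ (s.I \ e.L) := by
    by_cases hL : ℓ ∈ e.L
    · exact hL.symm.imp id (fun hI => ⟨hI, fun hU => not_mem_I_of_mem_U hU hℓ.1⟩) |> .inl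
    · exact .inr ⟨hℓ.1, hL⟩
  exact hq _ (.emit X ℓ B (fun _ => Beh.pass) hℓ hX.symm hB fun _ _ => .halt _)
    (hf.of_step (.sync ⟨_, rfl, .inr ⟨ℓ, hU, rfl⟩, .choice_left .seq⟩ hT))

theorem Safe.environment (hI : i.I = s.I) (hU : i.U = s.U) {q : P} {ℓ : Λ}
    (hq : Safe s e h i X q) (hℓ : ℓ ∉ s.L)
    (hX : Obs.lab ℓ ∈ (par s e).out X ∨ ℓ ∈ (par s e).inp X) :
    Safe s e h i ((par s e).after X [Obs.lab ℓ]) q := by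
  intro B hB hf
  have hi : ℓ ∉ i.L := by rwa [LTS.L, hI, hU]
  have hU : ℓ ∈ e.U ∪ (e.I \ s.U) := by
    rcases hX with ⟨hX | ⟨ℓ', hX, hE⟩, -⟩ | ⟨hX | hX, -⟩
    · cases hX
    · cases hE
      exact .inl (hX.resolve_left fun hs => hℓ (.inr hs))
    · exact absurd (.inl hX.1) hℓ
    · exact .inr hX
  exact hq _ (.environment X ℓ B (fun _ => Beh.pass) hX hℓ hB fun _ _ => .halt _)
    (hf.of_step (.test ⟨_, rfl, .inr ⟨ℓ, .inl hU, rfl⟩, .choice_left .seq⟩ hi))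

theorem Safe.delta_mem_out {q : P} (hq : Safe s e h i X q) (hi : i.Quiescent q) :
    Obs.delta ∈ s.out (Prod.fst '' X) := by
  by_contra hn
  exact hq _ (.quiescenceFail X (fun _ => Beh.pass) hn fun _ _ => .halt _)
    ((canFail_fail q).of_step
      (.theta ⟨_, rfl, .inl (.inr (.inl rfl)), .choice_left .seq⟩ ⟨rfl, hi⟩))

theorem Safe.quiescence {q : P} (hq : Safe s e h i X q) (hi : i.Quiescent q)
    (hX : Obs.delta ∈ (par s e).out X) :
    Safe s e h i ((par s e).after X [Obs.delta]) q := fun B hB hf =>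
  hq _ (.quiescence X B (fun _ => Beh.pass) (hq.delta_mem_out hi) hX hB fun _ _ => .halt _)
    (hf.of_step (.theta ⟨_, rfl, .inl (.inr (.inl rfl)), .choice_left .seq⟩ ⟨rfl, hi⟩))

/-- The tests for the left component follow a label of the composition of the implementations.
For an output of `i_e` that `i_s` receives, it is the safety of the right component that makes
the label an admissible input of the test. -/
theorem Safe.par_step {i' : LTS Λ P'} (hI : i.I = s.I) (hU : i.U = s.U) (hI' : i'.I = e.I)
    (hU' : i'.U = e.U) {q q₁ : P} {r r₁ : P'} {ℓ : Λ} (hq : Safe s e h i X q)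
    (hr : Safe e s h.symm i' (Prod.swap '' X) r)
    (hX : Obs.lab ℓ ∈ (par s e).out X ∨ ℓ ∈ (par s e).inp X)
    (hT : ParStep i i' (q, r) (Act.lab ℓ) (q₁, r₁)) :
    Safe s e h i ((par s e).after X [Obs.lab ℓ]) q₁ := by
  have hL : i.L = s.L := by rw [LTS.L, hI, hU, LTS.L]
  have hL' : i'.L = e.L := by rw [LTS.L, hI', hU', LTS.L]
  have follow (hT : i.T q (Act.lab ℓ) q₁) (hs : ℓ ∈ s.I → ℓ ∈ s.inp (Prod.fst '' X)) :
      Safe s e h i ((par s e).after X [Obs.lab ℓ]) q₁ := by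
    have hℓ := i.wf _ _ _ hT
    rw [hI, hU] at hℓ
    rcases hℓ with hℓ | hℓ
    · exact hq.input (hs hℓ) hX hT
    · exact (hq.output hℓ hT).2
  have inp_of_not_out (hn : ℓ ∉ e.U) (hs : ℓ ∈ s.I) : ℓ ∈ s.inp (Prod.fst '' X) := by
    refine inp_fst_of_inp_par (hX.resolve_left ?_) (.inl hs)
    rintro ⟨hX | ⟨ℓ', hX, hE⟩, -⟩
    · cases hX
    · cases hE
      exact hX.elim (fun hX => not_mem_I_of_mem_U hX hs) hn
  cases hT with
  | left hT hn => exact follow hT (inp_of_not_out fun hU => hn (hL' ▸ .inr hU))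
  | right hT hn => exact hq.environment hI hU (hL ▸ hn) hX
  | sync hT hT' =>
    refine follow hT fun hs => ?_
    by_cases hℓ : ℓ ∈ e.U
    · have hc := (hr.output hℓ hT').1.2.1.resolve_right fun hn => hn (.inl hs)
      rwa [snd_image_swap] at hc
    · exact inp_of_not_out hℓ hs

/-- Both components of a state that the implementations reach by a utrace of the specification
are safe for the set of states that the specification reaches by it. -/
theorem safe_of_utrace {i' : LTS Λ P'} (hE : i.InputEnabled) (hI : i.I = s.I) (hU : i.U = s.U)
    (hE' : i'.InputEnabled) (hI' : i'.I = e.I) (hU' : i'.U = e.U)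
    (hts : PassesSuite i (combinedTests s e h))
    (hte : PassesSuite i' (combinedTests e s h.symm)) {σ : List (Obs Λ)}
    (hσ : σ ∈ (par s e).Utraces) {q : P} {r : P'}
    (hw : (par i i').Weak (par i i').q0 σ (q, r)) :
    Safe s e h i ((par s e).after {(par s e).q0} σ) q ∧
      Safe e s h.symm i' (Prod.swap '' (par s e).after {(par s e).q0} σ) r := by
  have hi : Composable i i' := by rwa [Composable, hU, hU']
  induction σ using List.reverseRecOn generalizing q r with
  | nil =>
    obtain ⟨hq, hr⟩ := par_eps_iff.1 hw
    refine ⟨(safe_of_passesSuite hts).of_eps hq, ?_⟩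
    rw [← par_after_swap, Set.image_singleton]
    exact (safe_of_passesSuite hte).of_eps hr
  | append_singleton σ a ih =>
    obtain ⟨⟨q₀, r₀⟩, ⟨q₁, r₁⟩, hw, hT, hε⟩ := (weak_snoc ..).1 hw
    obtain ⟨hq, hr⟩ := ih (utraces_of_append hσ) hw
    obtain ⟨hqε, hrε⟩ := par_eps_iff.1 hε
    rw [after_append_singleton]
    suffices Safe s e h i ((par s e).after ((par s e).after {(par s e).q0} σ) [a]) q₁ ∧
        Safe e s h.symm i'
          (Prod.swap '' (par s e).after ((par s e).after {(par s e).q0} σ) [a]) r₁ from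
      ⟨this.1.of_eps hqε, this.2.of_eps hrε⟩
    rw [← par_after_swap]
    cases a with
    | delta =>
      have hX := delta_mem_out_of_utrace hσ
      obtain ⟨hT, hQ⟩ := hT
      cases hT
      exact ⟨hq.quiescence (quiescent_of_par_quiescent hi hE' hQ) hX,
        hr.quiescence (quiescent_of_par_quiescent hi.symm hE
          (par_step_swap (a := .delta) ⟨rfl, hQ⟩).2) (par_out_swap hX)⟩
    | lab ℓ =>
      have hX := mem_out_or_mem_inp_of_utrace hσ
      refine ⟨hq.par_step hI hU hI' hU' hr hX hT, hr.par_step hI' hU' hI hU ?_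
        (hX.imp par_out_swap par_inp_swap) (parStep_swap hT)⟩
      rwa [swap_image_swap]

theorem Safe.lab_mem_out {i' : LTS Λ P'} (hU : i.U = s.U) {q : P} {r : P'} {ℓ : Λ}
    (hq : Safe s e h i X q) (hℓ : ℓ ∈ s.U) {y : P × P'}
    (hT : ParStep i i' (q, r) (Act.lab ℓ) y) : Obs.lab ℓ ∈ (par s e).out X := by
  cases hT with
  | left hT _ => exact (hq.output hℓ hT).1.2.2
  | right _ hn => exact absurd (.inr (hU ▸ hℓ)) hn
  | sync hT _ => exact (hq.output hℓ hT).1.2.2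

end Tests

end CompTest

/-! ### Compositionality -/

theorem mainTheorem6 {Λ : Type*} {Qs Qe Qis Qie : Type*}
    (s : CompTest.LTS Λ Qs) (e : CompTest.LTS Λ Qe)
    (i_s : CompTest.LTS Λ Qis) (i_e : CompTest.LTS Λ Qie)
    (h : CompTest.Composable s e)
    (hs : s.UtraceClosed) (he : e.UtraceClosed)
    (hEs : i_s.InputEnabled) (hIs : i_s.I = s.I) (hUs : i_s.U = s.U)
    (hEe : i_e.InputEnabled) (hIe : i_e.I = e.I) (hUe : i_e.U = e.U)
    (hts : CompTest.PassesSuite i_s (CompTest.combinedTests s e h))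
    (hte : CompTest.PassesSuite i_e (CompTest.combinedTests e s (Disjoint.symm h))) :
    CompTest.Uioco (CompTest.par i_s i_e) (CompTest.par s e) := by
  have hi : CompTest.Composable i_s i_e := by rwa [CompTest.Composable, hUs, hUe]
  refine ⟨CompTest.par_inputEnabled hEs hEe, ?_, ?_, ?_⟩
  · simp only [CompTest.par, hIs, hUs, hIe, hUe]
  · simp only [CompTest.par, hUs, hUe]
  rintro σ hσ x ⟨hx, ⟨q, r⟩, hw, y, hT⟩
  obtain ⟨hq, hr⟩ := CompTest.safe_of_utrace hEs hIs hUs hEe hIe hUe hts hte hσ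
    (CompTest.LTS.mem_after_q0.1 hw)
  cases x with
  | lab ℓ =>
    rcases hx with hx | ⟨ℓ', hx | hx, hE⟩
    · cases hx
    · cases hE
      exact hq.lab_mem_out hUs (hUs ▸ hx) hT
    · cases hE
      have hout := CompTest.par_out_swap
        (hr.lab_mem_out hUe (hUe ▸ hx) (CompTest.parStep_swap hT))
      rwa [CompTest.swap_image_swap] at hout
  | delta =>
    have hQ := hT.2
    have hQ' := (CompTest.par_step_swap (a := .delta) ⟨rfl, hQ⟩).2
    obtain ⟨-, _, ⟨⟨p, r₁⟩, hp, rfl⟩, -, -, hpq⟩ :=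
      hq.delta_mem_out (CompTest.quiescent_of_par_quiescent hi hEe hQ)
    obtain ⟨-, _, ⟨_, ⟨⟨p₁, r'⟩, hr', rfl⟩, rfl⟩, -, -, hrq⟩ :=
      hr.delta_mem_out (CompTest.quiescent_of_par_quiescent hi.symm hEs hQ')
    -- The tests give two pairs, each with one quiescent component; rectangularity combines them.
    exact ⟨.inl rfl, (p, r'), (CompTest.rectangular_after h hs he σ).1 _ hp _ hr', (p, r'), rfl,
      (CompTest.par_quiescent_iff h).2
        ⟨CompTest.blockedBy_of_quiescent hpq _, CompTest.blockedBy_of_quiescent hrq _⟩⟩
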